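/- Let $\mathbb K$ be a field, let $d\ge 0$ be an integer and let $V$ be a vector space over $\mathbb K$ of dimension $d+1$. A linear map $V\to V$ is *multiplicity-free* if its eigenspaces span $V$ and each of them has dimension one; its *primitive idempotent* for an eigenvalue $\theta$ is the linear map that is the identity on the eigenspace of $\theta$ and zero on the other eigenspaces. Let $$\Phi=(A;\{E_i\}_{i=0}^d;A^*;\{E^*_i\}_{i=0}^d)$$ be a thin Hessenberg (TH) system on $V$. That is, $A,A^*:V\to V$ are multiplicity-free linear maps, $\{E_i\}_{i=0}^d$ (resp. $\{E_i^*\}_{i=0}^d$) is an ordering of the primitive idempotents of $A$ (resp. $A^*$), and for $0\le i,j\le d$ each of $E_iA^*E_j$ and $E^*_iAE^*_j$ is zero if $i-j>1$ and nonzero if $i-j=1$. Let $\theta_i$ (resp. $\theta^*_i$) be the eigenvalue of $A$ (resp. $A^*$) corresponding to $E_i$ (resp. $E^*_i$). For $0\le i\le d$ put $$U_i=(E^*_0V+\cdots+E^*_iV)\cap(E_0V+\cdots+E_{d-i}V),$$ and for $1\le i\le d$ let $\phi_i\in\mathbb K$ be the eigenvalue of $(A-\theta_{d-i+1}I)(A^*-\theta^*_iI)$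 on $U_i$ (this map acts on $U_i\neq 0$ as a nonzero scalar). For $0\le i\le d+1$ put $$\eta_i(\lambda)=\prod_{h=0}^{i-1}(\lambda-\theta_{d-h}),\qquad \tau^*_i(\lambda)=\prod_{h=0}^{i-1}(\lambda-\theta^*_h),\qquad \eta^*_i(\lambda)=\prod_{h=0}^{i-1}(\lambda-\theta^*_{d-h}),$$ and define $$\ell_i=\frac{\eta^*_d(\theta^*_0)}{\tau^*_i(\theta^*_i)\,\eta^*_{d-i}(\theta^*_i)}\quad(0\le i\le d),\qquad p(\lambda,\mu)=\sum_{h=0}^d\frac{\eta_h(\lambda)\,\tau^*_h(\mu)}{\phi_1\phi_2\cdots\phi_h}\in\mathbb K[\lambda,\mu].$$ Let $0\ne\xi\in E_0V$. Then $\{E^*_i\xi\}_{i=0}^d$ is a basis of $V$; let $H$ be the matrix representing $A$ with respect to it, so that $H_{ij}=0$ for $i-j>1$ and $H_{ij}\ne0$ for $i-j=1$, and put $c_H=\prod_{i=1}^dH_{i,i-1}$. Let $\{s_i\}_{i=0}^{d+1}$ be the polynomials in $\mathbb K[\lambda]$ determined by $s_0=1$, $$\lambda s_j=\sum_{i=0}^{j+1}H_{ij}s_i\quad(0\le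 j\le d-1),\qquad \lambda s_d=c_H^{-1}s_{d+1}+\sum_{i=0}^dH_{id}s_i,$$ and put $t_i=s_i/\ell_i$ for $0\le i\le d$ and $t_{d+1}=s_{d+1}$. Then: 1. $t_i=p(\lambda,\theta^*_i)$ for $0\le i\le d$; 2. $t_{d+1}=\prod_{i=0}^d(\lambda-\theta_i)$; 3. $s_i=\ell_i\,p(\lambda,\theta^*_i)$ for $0\le i\le d$; 4. $s_{d+1}=\prod_{i=0}^d(\lambda-\theta_i)$. -/

import Mathlib

open Polynomial

/-- `A` is multiplicity-free: the eigenspaces of `A` span the whole space, and each eigenspace of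
`A` (for an actual eigenvalue) has dimension one. -/
def IsMultiplicityFree {K V : Type*} [Field K] [AddCommGroup V] [Module K V]
    (A : Module.End K V) : Prop :=
  (⨆ c : K, A.eigenspace c) = ⊤ ∧
    ∀ c : K, A.HasEigenvalue c → Module.finrank K (A.eigenspace c) = 1

/-- `F` is the primitive idempotent of `A` corresponding to the eigenvalue `c`: it is the identity
on the eigenspace of `c` and vanishes on all other eigenspaces. -/
def IsPrimitiveIdempotent {K V : Type*} [Field K] [AddCommGroup V] [Module K V]
    (A : Module.End K V) (c : K) (F : Module.End K V) : Prop :=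
  A.HasEigenvalue c ∧ (∀ v ∈ A.eigenspace c, F v = v) ∧
    ∀ c₁ : K, c₁ ≠ c → ∀ v ∈ A.eigenspace c₁, F v = 0

/-- `θ` lists every eigenvalue of `A` exactly once, and `E i` is the primitive idempotent of `A`
corresponding to `θ i`. -/
def IsIdempotentOrdering {K V : Type*} [Field K] [AddCommGroup V] [Module K V] {d : ℕ}
    (A : Module.End K V) (E : Fin (d + 1) → Module.End K V) (θ : Fin (d + 1) → K) : Prop :=
  Function.Injective θ ∧ (∀ c : K, A.HasEigenvalue c ↔ ∃ i, θ i = c) ∧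
    ∀ i, IsPrimitiveIdempotent A (θ i) (E i)

/-- A thin Hessenberg system `(A; {E i}; A*; {E* i})` of diameter `d` on the vector space `V` of
dimension `d + 1`. -/
structure THSystem (K V : Type*) [Field K] [AddCommGroup V] [Module K V] (d : ℕ) where
  finrank_eq : Module.finrank K V = d + 1
  A : Module.End K V
  E : Fin (d + 1) → Module.End K V
  Astar : Module.End K V
  Estar : Fin (d + 1) → Module.End K V
  multFree : IsMultiplicityFree A
  multFree_star : IsMultiplicityFree Astar
  ordering : ∃ θ : Fin (d + 1) → K, IsIdempotentOrdering A E θ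
  ordering_star : ∃ θ : Fin (d + 1) → K, IsIdempotentOrdering Astar Estar θ
  hess_zero : ∀ i j : Fin (d + 1), (j : ℕ) + 1 < i → E i * Astar * E j = 0
  hess_ne_zero : ∀ i j : Fin (d + 1), (i : ℕ) = j + 1 → E i * Astar * E j ≠ 0
  hess_star_zero : ∀ i j : Fin (d + 1), (j : ℕ) + 1 < i → Estar i * A * Estar j = 0
  hess_star_ne_zero : ∀ i j : Fin (d + 1), (i : ℕ) = j + 1 → Estar i * A * Estar j ≠ 0

/-- `τ_i = (λ - θ_0)(λ - θ_1) ⋯ (λ - θ_{i-1})`, for `0 ≤ i ≤ d + 1`. -/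
noncomputable def tauPoly {K : Type*} [Field K] {d : ℕ} (θ : Fin (d + 1) → K) (i : ℕ) : K[X] :=
  ∏ h : Fin (d + 1) with h.val < i, (X - C (θ h))

/-- `η_i = (λ - θ_d)(λ - θ_{d-1}) ⋯ (λ - θ_{d-i+1})`, for `0 ≤ i ≤ d + 1`
(note that `h.rev` is the index `d - h`). -/
noncomputable def etaPoly {K : Type*} [Field K] {d : ℕ} (θ : Fin (d + 1) → K) (i : ℕ) : K[X] :=
  ∏ h : Fin (d + 1) with h.val < i, (X - C (θ h.rev))

/-- A square matrix is Hessenberg when each entry below the subdiagonal is zero and each entry on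
the subdiagonal is nonzero. -/
def IsHessenberg {K : Type*} [Field K] {d : ℕ} (H : Matrix (Fin (d + 1)) (Fin (d + 1)) K) : Prop :=
  (∀ i j : Fin (d + 1), (j : ℕ) + 1 < i → H i j = 0) ∧
    ∀ i j : Fin (d + 1), (i : ℕ) = j + 1 → H i j ≠ 0

/-- The product `c_H` of the subdiagonal entries of `H`. -/
def subdiagProd {K : Type*} [Field K] {d : ℕ} (H : Matrix (Fin (d + 1)) (Fin (d + 1)) K) : K :=
  ∏ i : Fin d, H i.succ i.castSucc

/-- The recursion for the polynomials `f_0, …, f_{d+1}` of a Hessenberg matrix `H`: `f_0 = 1`,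
the equation `λ f_j = ∑_{i ≤ j+1} H_{ij} f_i` solved for `f_{j+1}` when `j < d`, and
`λ f_d = c_H⁻¹ f_{d+1} + ∑_{i ≤ d} H_{id} f_i` solved for `f_{d+1}`.
Only the values at indices at most `d + 1` are meaningful. -/
noncomputable def hessPolyAux {K : Type*} [Field K] {d : ℕ}
    (H : Matrix (Fin (d + 1)) (Fin (d + 1)) K) : ℕ → K[X]
  | 0 => 1
  | j + 1 =>
      C (if j < d then (H (Fin.ofNat (d + 1) (j + 1)) (Fin.ofNat (d + 1) j))⁻¹
          else subdiagProd H) *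
        (X * hessPolyAux H j -
          ∑ i : Fin (j + 1),
            C (H (Fin.ofNat (d + 1) (i : ℕ)) (Fin.ofNat (d + 1) j)) * hessPolyAux H (i : ℕ))

/-- The polynomials `f_0, …, f_{d+1}` of a Hessenberg matrix. -/
noncomputable def hessPoly {K : Type*} [Field K] {d : ℕ}
    (H : Matrix (Fin (d + 1)) (Fin (d + 1)) K) (i : Fin (d + 2)) : K[X] :=
  hessPolyAux H (i : ℕ)

/-- The polynomials of a Hessenberg matrix satisfy their three defining equations. -/
theorem hessPoly_spec {K : Type*} [Field K] {d : ℕ}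
    (H : Matrix (Fin (d + 1)) (Fin (d + 1)) K) (hH : IsHessenberg H) :
    hessPoly H 0 = 1 ∧
    (∀ j : Fin (d + 1), (j : ℕ) < d →
      X * hessPoly H j.castSucc =
        ∑ i : Fin (d + 1) with i.val ≤ j.val + 1, C (H i j) * hessPoly H i.castSucc) ∧
    X * hessPoly H (Fin.last d).castSucc =
      C (subdiagProd H)⁻¹ * hessPoly H (Fin.last (d + 1)) +
        ∑ i : Fin (d + 1), C (H i (Fin.last d)) * hessPoly H i.castSucc := by
  have key : ∀ j : ℕ, j ≤ d → ∀ g : Fin (d + 1) → K[X],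
      ∑ i : Fin (d + 1) with i.val ≤ j, g i
        = ∑ i : Fin (j + 1), g (Fin.ofNat (d + 1) (i : ℕ)) := by
    intro j hj g
    symm
    refine Finset.sum_bij (fun i _ => Fin.ofNat (d + 1) (i : ℕ)) ?_ ?_ ?_ ?_
    · intro a _
      have := a.2
      simp [Nat.mod_eq_of_lt (show (a : ℕ) < d + 1 by omega)]
      omega
    · intro a _ b _ hab
      have h1 := a.2
      have h2 := b.2
      have := congrArg Fin.val hab
      simp [Nat.mod_eq_of_lt (show (a : ℕ) < d + 1 by omega),
        Nat.mod_eq_of_lt (show (b : ℕ) < d + 1 by omega)] at this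
      exact Fin.ext this
    · intro b hb
      simp at hb
      refine ⟨⟨b, by omega⟩, Finset.mem_univ _, ?_⟩
      apply Fin.ext
      simp
    · intro a _
      rfl
  refine ⟨by simp [hessPoly, hessPolyAux], ?_, ?_⟩
  · intro j hj
    have e1 := key (j + 1) (by omega) (fun i => C (H i j) * hessPoly H i.castSucc)
    rw [e1, Fin.sum_univ_castSucc]
    have hsub : H (Fin.ofNat (d + 1) (j + 1)) j ≠ 0 := by
      apply hH.2
      simp [Nat.mod_eq_of_lt (show (j : ℕ) + 1 < d + 1 by omega)]
    have hjj : Fin.ofNat (d + 1) (j : ℕ) = j := by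
      apply Fin.ext; simp
    have hv : ∀ i : ℕ, i ≤ d → hessPoly H (Fin.ofNat (d + 1) i).castSucc = hessPolyAux H i := by
      intro i hi
      simp [hessPoly, Nat.mod_eq_of_lt (show i < d + 1 by omega)]
    have hlast : hessPolyAux H ((j : ℕ) + 1) = C (H (Fin.ofNat (d + 1) (j + 1)) j)⁻¹ *
        (X * hessPolyAux H j - ∑ i : Fin ((j : ℕ) + 1),
          C (H (Fin.ofNat (d + 1) (i : ℕ)) j) * hessPolyAux H (i : ℕ)) := by
      rw [hessPolyAux, if_pos hj, hjj]
    have hs : ∑ i : Fin ((j : ℕ) + 1),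
        C (H (Fin.ofNat (d + 1) ((i.castSucc : Fin ((j : ℕ) + 1 + 1)) : ℕ)) j) *
          hessPoly H (Fin.ofNat (d + 1) ((i.castSucc : Fin ((j : ℕ) + 1 + 1)) : ℕ)).castSucc
        = ∑ i : Fin ((j : ℕ) + 1),
          C (H (Fin.ofNat (d + 1) (i : ℕ)) j) * hessPolyAux H (i : ℕ) := by
      refine Finset.sum_congr rfl fun i _ => ?_
      rw [hv _ (by have := i.2; simp; omega)]
      rfl
    rw [hs, Fin.val_last, hv _ (by omega), hlast, ← mul_assoc, ← C_mul, mul_inv_cancel₀ hsub]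
    simp [hessPoly]
  · have hc : subdiagProd H ≠ 0 := by
      refine Finset.prod_ne_zero_iff.2 fun i _ => hH.2 _ _ ?_
      simp
    have hdd : Fin.ofNat (d + 1) d = Fin.last d := by
      apply Fin.ext; simp
    have e1 := key d le_rfl (fun i => C (H i (Fin.last d)) * hessPoly H i.castSucc)
    have e2 : (Finset.univ.filter fun i : Fin (d + 1) => (i : ℕ) ≤ d) = Finset.univ := by
      ext i; simp; omega
    have hlast : hessPolyAux H (d + 1) = C (subdiagProd H) *
        (X * hessPolyAux H d - ∑ i : Fin (d + 1),
          C (H (Fin.ofNat (d + 1) (i : ℕ)) (Fin.last d)) * hessPolyAux H (i : ℕ)) := by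
      rw [hessPolyAux, if_neg (lt_irrefl _), hdd]
    have e3 : hessPoly H (Fin.last (d + 1)) = hessPolyAux H (d + 1) := rfl
    rw [e3, hlast, ← mul_assoc, ← C_mul, inv_mul_cancel₀ hc]
    have e4 : ∑ i : Fin (d + 1),
          C (H (Fin.ofNat (d + 1) (i : ℕ)) (Fin.last d)) * hessPolyAux H (i : ℕ)
        = ∑ i : Fin (d + 1), C (H i (Fin.last d)) * hessPoly H i.castSucc := by
      refine Finset.sum_congr rfl fun i _ => ?_
      have : Fin.ofNat (d + 1) (i : ℕ) = i := by
        apply Fin.ext; simp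
      rw [this]
      rfl
    rw [e4]
    simp [hessPoly]

/-- Elementary facts on the primitive idempotents of a multiplicity-free map. -/
theorem IsIdempotentOrdering.facts {K V : Type*} [Field K] [AddCommGroup V] [Module K V] {d : ℕ}
    {A : Module.End K V} {E : Fin (d + 1) → Module.End K V} {θ : Fin (d + 1) → K}
    (hA : IsMultiplicityFree A) (h : IsIdempotentOrdering A E θ) :
    (∀ i v, A (E i v) = θ i • E i v) ∧ (∀ i v, E i (A v) = θ i • E i v) ∧
    (∀ v, ∑ i, E i v = v) ∧ (∀ i v, A v = θ i • v → E i v = v) ∧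
    (∀ i j v, j ≠ i → E i (E j v) = 0) ∧ ∀ i, E i ≠ 0 := by
  obtain ⟨hinj, hev, hE⟩ := h
  have f4 : ∀ i v, A v = θ i • v → E i v = v := fun i v hv =>
    (hE i).2.1 v (Module.End.mem_eigenspace_iff.2 hv)
  have f0 : ∀ i c v, A v = c • v → c ≠ θ i → E i v = 0 := fun i c v hv hc =>
    (hE i).2.2 c hc v (Module.End.mem_eigenspace_iff.2 hv)
  have ind : ∀ P : V → Prop, (∀ (v : V) (c : K), A v = c • v → P v) → P 0 →
      (∀ v w, P v → P w → P (v + w)) → ∀ v, P v := by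
    intro P h1 h2 h3 v
    have hv : v ∈ ⨆ c : K, A.eigenspace c := by rw [hA.1]; trivial
    exact Submodule.iSup_induction _ (motive := P) hv
      (fun c x hx => h1 x c (Module.End.mem_eigenspace_iff.1 hx)) h2 h3
  have f1 : ∀ i v, A (E i v) = θ i • E i v := by
    intro i
    apply ind (fun v => A (E i v) = θ i • E i v)
    · intro v c hv
      by_cases hc : c = θ i
      · subst hc; rw [f4 i v hv, hv]
      · simp [f0 i c v hv hc]
    · simp
    · intro v w hv hw; simp [hv, hw]
  refine ⟨f1, ?_, ?_, f4, ?_, ?_⟩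
  · intro i
    apply ind (fun v => E i (A v) = θ i • E i v)
    · intro v c hv
      by_cases hc : c = θ i
      · subst hc; rw [hv, map_smul]
      · rw [hv, map_smul, f0 i c v hv hc]; simp
    · simp
    · intro v w hv hw; simp [hv, hw]
  · apply ind (fun v => ∑ i, E i v = v)
    · intro v c hv
      by_cases h0 : v = 0
      · simp [h0]
      · obtain ⟨k, rfl⟩ := (hev c).1
          (Module.End.hasEigenvalue_of_hasEigenvector
            ⟨Module.End.mem_eigenspace_iff.2 hv, h0⟩)
        rw [Finset.sum_eq_single k, f4 k v hv]
        · intro b _ hb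
          exact f0 b _ v hv fun hh => hb (hinj hh).symm
        · simp
    · simp
    · intro v w hv hw; simp [Finset.sum_add_distrib, hv, hw]
  · intro i j v hij
    exact f0 i _ _ (f1 j v) fun hh => hij (hinj hh)
  · intro i hi
    obtain ⟨v, hv⟩ := (hE i).1.exists_hasEigenvector
    have := f4 i v (Module.End.mem_eigenspace_iff.1 hv.1)
    rw [hi] at this
    exact hv.2 this.symm

/-- The subspace `E_0 V + E_1 V + ⋯ + E_n V`. -/
def idempotentFlag {K V : Type*} [Field K] [AddCommGroup V] [Module K V] {d : ℕ}
    (E : Fin (d + 1) → Module.End K V) (n : ℕ) : Submodule K V :=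
  ⨆ j : {j : Fin (d + 1) // (j : ℕ) ≤ n}, LinearMap.range (E j)

theorem idempotentFlag_induction {K V : Type*} [Field K] [AddCommGroup V] [Module K V] {d : ℕ}
    {E : Fin (d + 1) → Module.End K V} {n : ℕ} {P : V → Prop}
    (h1 : ∀ j : Fin (d + 1), (j : ℕ) ≤ n → ∀ v, P (E j v)) (h2 : P 0)
    (h3 : ∀ v w, P v → P w → P (v + w)) {u : V} (hu : u ∈ idempotentFlag E n) : P u := by
  refine Submodule.iSup_induction _ (motive := P) hu ?_ h2 h3
  rintro ⟨j, hj⟩ _ ⟨v, rfl⟩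
  exact h1 j hj v

theorem mem_idempotentFlag {K V : Type*} [Field K] [AddCommGroup V] [Module K V] {d : ℕ}
    (E : Fin (d + 1) → Module.End K V) {n : ℕ} (j : Fin (d + 1)) (hj : (j : ℕ) ≤ n) (v : V) :
    E j v ∈ idempotentFlag E n :=
  Submodule.mem_iSup_of_mem (p := fun j : {j : Fin (d + 1) // (j : ℕ) ≤ n} =>
    LinearMap.range (E j)) ⟨j, hj⟩ ⟨v, rfl⟩

theorem idempotentFlag_lower {K V : Type*} [Field K] [AddCommGroup V] [Module K V] {d : ℕ}
    {A : Module.End K V} {E : Fin (d + 1) → Module.End K V} {θ : Fin (d + 1) → K}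
    (f1 : ∀ i v, A (E i v) = θ i • E i v) {n : ℕ} (k : Fin (d + 1)) (hk : (k : ℕ) = n + 1)
    {u : V} (hu : u ∈ idempotentFlag E (n + 1)) : A u - θ k • u ∈ idempotentFlag E n := by
  refine idempotentFlag_induction (P := fun u => A u - θ k • u ∈ idempotentFlag E n)
    ?_ (by simp) ?_ hu
  · intro j hj v
    rw [f1, ← sub_smul]
    by_cases hjk : j = k
    · simp [hjk]
    · refine Submodule.smul_mem _ _ (mem_idempotentFlag E j ?_ v)
      have : (j : ℕ) ≠ k := fun h => hjk (Fin.ext h)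
      omega
  · intro v w hv hw
    have := Submodule.add_mem _ hv hw
    rw [map_add, smul_add]
    convert this using 1
    abel

theorem idempotentFlag_raise {K V : Type*} [Field K] [AddCommGroup V] [Module K V] {d : ℕ}
    {B : Module.End K V} {E : Fin (d + 1) → Module.End K V}
    (f3 : ∀ v, ∑ i, E i v = v)
    (hz : ∀ i j : Fin (d + 1), (j : ℕ) + 1 < i → E i * B * E j = 0) {n : ℕ} (c : K)
    {u : V} (hu : u ∈ idempotentFlag E n) : B u - c • u ∈ idempotentFlag E (n + 1) := by
  refine idempotentFlag_induction (P := fun u => B u - c • u ∈ idempotentFlag E (n + 1))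
    ?_ (by simp) ?_ hu
  · intro j hj v
    refine Submodule.sub_mem _ ?_
      (Submodule.smul_mem _ _ (mem_idempotentFlag E j (by omega) v))
    rw [← f3 (B (E j v))]
    refine Submodule.sum_mem _ fun k _ => ?_
    by_cases hk : (k : ℕ) ≤ n + 1
    · exact mem_idempotentFlag E k hk _
    · have := congrArg (fun T : Module.End K V => T v) (hz k j (by omega))
      simp only [Module.End.mul_apply, LinearMap.zero_apply] at this
      rw [this]
      exact Submodule.zero_mem _
  · intro v w hv hw
    have := Submodule.add_mem _ hv hw
    rw [map_add, smul_add]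
    convert this using 1
    abel

namespace THSystem

variable {K V : Type*} [Field K] [AddCommGroup V] [Module K V] {d : ℕ}

/-- The eigenvalue sequence `θ_0, …, θ_d`. -/
noncomputable def eigenvalue (Φ : THSystem K V d) : Fin (d + 1) → K := Φ.ordering.choose

/-- The dual eigenvalue sequence `θ*_0, …, θ*_d`. -/
noncomputable def dualEigenvalue (Φ : THSystem K V d) : Fin (d + 1) → K := Φ.ordering_star.choose

theorem eigenvalue_spec (Φ : THSystem K V d) : IsIdempotentOrdering Φ.A Φ.E Φ.eigenvalue :=
  Φ.ordering.choose_spec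

theorem dualEigenvalue_spec (Φ : THSystem K V d) :
    IsIdempotentOrdering Φ.Astar Φ.Estar Φ.dualEigenvalue :=
  Φ.ordering_star.choose_spec

theorem exists_poly (Φ : THSystem K V d) {ξ : V} (hξ : ξ ∈ LinearMap.range (Φ.E 0)) (h0 : ξ ≠ 0) :
    ∀ (n : ℕ) (hn : n < d + 1) (v : V), v ∈ LinearMap.range (Φ.E ⟨n, hn⟩) →
      ∃ q : K[X], q.natDegree ≤ n ∧ aeval Φ.Astar q ξ = v := by
  obtain ⟨f1, -, f3, f4, f5, -⟩ := Φ.eigenvalue_spec.facts Φ.multFree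
  have one : ∀ i, ∀ u ∈ LinearMap.range (Φ.E i), u ≠ 0 → ∀ v ∈ LinearMap.range (Φ.E i),
      ∃ c : K, c • u = v := by
    rintro i _ ⟨u, rfl⟩ hu _ ⟨v, rfl⟩
    have hfr := Φ.multFree.2 _ (Φ.eigenvalue_spec.2.2 i).1
    have hmem : ∀ w, Φ.E i w ∈ Φ.A.eigenspace (Φ.eigenvalue i) := fun w =>
      Module.End.mem_eigenspace_iff.2 (f1 i w)
    obtain ⟨c, hc⟩ := (finrank_eq_one_iff_of_nonzero' (⟨_, hmem u⟩ : Φ.A.eigenspace _)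
      (by simpa [Subtype.ext_iff] using hu)).1 hfr ⟨_, hmem v⟩
    exact ⟨c, by simpa using congrArg Subtype.val hc⟩
  intro n
  induction n using Nat.strong_induction_on with
  | _ n ih =>
    intro hn v hv
    rcases n with _ | n
    · obtain ⟨c, hc⟩ := one _ ξ hξ h0 v hv
      exact ⟨C c, by simp, by simpa using hc⟩
    · have hne := Φ.hess_ne_zero ⟨n + 1, hn⟩ ⟨n, by omega⟩ rfl
      obtain ⟨w, hw⟩ : ∃ w, Φ.E ⟨n + 1, hn⟩ (Φ.Astar (Φ.E ⟨n, by omega⟩ w)) ≠ 0 := by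
        by_contra! hcon
        exact hne (LinearMap.ext fun x => by simpa using hcon x)
      set u := Φ.E ⟨n, by omega⟩ w with hu
      obtain ⟨c, hc⟩ := one _ _ ⟨_, rfl⟩ hw v hv
      obtain ⟨q, hq, hqu⟩ := ih n (by omega) (by omega) u ⟨w, rfl⟩
      have hz : ∀ k : Fin (d + 1), n + 1 < (k : ℕ) → Φ.E k (Φ.Astar u) = 0 := by
        intro k hk
        have := Φ.hess_zero k ⟨n, by omega⟩ hk
        simpa using congrArg (fun T : Module.End K V => T w) this
      have hr : ∀ k : Fin (d + 1), ∃ r : K[X], (k : ℕ) ≤ n →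
          r.natDegree ≤ n + 1 ∧ aeval Φ.Astar r ξ = Φ.E k (Φ.Astar u) := by
        intro k
        by_cases hk : (k : ℕ) ≤ n
        · obtain ⟨r, hr1, hr2⟩ := ih k (by omega) k.2 _ ⟨Φ.Astar u, rfl⟩
          exact ⟨r, fun _ => ⟨by omega, hr2⟩⟩
        · exact ⟨0, fun h => absurd h hk⟩
      choose r hr using hr
      refine ⟨C c * (X * q - ∑ k : Fin (d + 1) with k.val ≤ n, r k), ?_, ?_⟩
      · refine (natDegree_C_mul_le _ _).trans ((natDegree_sub_le _ _).trans (max_le ?_ ?_))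
        · refine natDegree_mul_le.trans ?_
          have := natDegree_X_le (R := K)
          omega
        · refine natDegree_sum_le_of_forall_le _ _ fun k hk => ?_
          exact (hr k (by simpa using hk)).1
      · have hsum := f3 (Φ.Astar u)
        rw [← Finset.sum_filter_add_sum_filter_not _ (fun k : Fin (d + 1) => (k : ℕ) ≤ n)] at hsum
        have h2 : ∑ k : Fin (d + 1) with ¬ k.val ≤ n, Φ.E k (Φ.Astar u)
            = Φ.E ⟨n + 1, hn⟩ (Φ.Astar u) := by
          refine Finset.sum_eq_single_of_mem _ (by simp) fun b hb hbn => hz b ?_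
          have h3 : n < (b : ℕ) := by simpa using hb
          have h4 : (b : ℕ) ≠ n + 1 := fun h => hbn (Fin.ext h)
          omega
        rw [h2] at hsum
        have h5 : ∑ k : Fin (d + 1) with k.val ≤ n, aeval Φ.Astar (r k) ξ
            = ∑ k : Fin (d + 1) with k.val ≤ n, Φ.E k (Φ.Astar u) :=
          Finset.sum_congr rfl fun k hk => (hr k (by simpa using hk)).2
        rw [← hc]
        simp only [map_mul, map_sub, map_sum, aeval_C, aeval_X, Module.End.mul_apply,
          LinearMap.sub_apply, LinearMap.sum_apply, Module.algebraMap_end_apply, hqu, h5]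
        rw [eq_sub_of_add_eq' hsum, smul_sub, Finset.smul_sum]

theorem Estar_aeval (Φ : THSystem K V d) (k : Fin (d + 1)) (q : K[X]) (v : V) :
    Φ.Estar k (aeval Φ.Astar q v) = q.eval (Φ.dualEigenvalue k) • Φ.Estar k v := by
  obtain ⟨-, f2, -⟩ := Φ.dualEigenvalue_spec.facts Φ.multFree_star
  induction q using Polynomial.induction_on' generalizing v with
  | add p q hp hq => simp [hp, hq, add_smul]
  | monomial n a =>
    induction n generalizing v with
    | zero => simp
    | succ n ih =>
      rw [← monomial_mul_X, map_mul, Module.End.mul_apply, ih]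
      simp [f2, smul_smul, pow_succ, mul_assoc]

theorem Estar_ne_zero (Φ : THSystem K V d) {ξ : V} (hξ : ξ ∈ LinearMap.range (Φ.E 0))
    (h0 : ξ ≠ 0) (k : Fin (d + 1)) : Φ.Estar k ξ ≠ 0 := by
  obtain ⟨-, -, f3, -⟩ := Φ.eigenvalue_spec.facts Φ.multFree
  obtain ⟨-, -, -, -, -, f6⟩ := Φ.dualEigenvalue_spec.facts Φ.multFree_star
  intro hk
  refine f6 k (LinearMap.ext fun v => ?_)
  rw [← f3 v, map_sum]
  refine Finset.sum_eq_zero fun j _ => ?_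
  obtain ⟨q, -, hq⟩ := Φ.exists_poly hξ h0 j j.2 (Φ.E j v) ⟨v, rfl⟩
  rw [← hq, Estar_aeval, hk, smul_zero]

/-- For a nonzero `ξ` in `E_0 V`, the vectors `E*_0 ξ, …, E*_d ξ` are linearly independent. -/
theorem standard_linearIndependent (Φ : THSystem K V d) {ξ : V}
    (hξ : ξ ∈ LinearMap.range (Φ.E 0)) (h0 : ξ ≠ 0) :
    LinearIndependent K fun i => Φ.Estar i ξ := by
  obtain ⟨f1, -⟩ := Φ.dualEigenvalue_spec.facts Φ.multFree_star
  exact Module.End.eigenvectors_linearIndependent' Φ.Astar Φ.dualEigenvalue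
    Φ.dualEigenvalue_spec.1 _
    fun i => ⟨Module.End.mem_eigenspace_iff.2 (f1 i ξ), Φ.Estar_ne_zero hξ h0 i⟩

/-- The standard basis `E*_0 ξ, …, E*_d ξ` of `V` attached to a nonzero vector `ξ` in `E_0 V`. -/
noncomputable def standardBasis (Φ : THSystem K V d) (ξ : V)
    (hξ : ξ ∈ LinearMap.range (Φ.E 0)) (h0 : ξ ≠ 0) : Module.Basis (Fin (d + 1)) K V :=
  basisOfLinearIndependentOfCardEqFinrank (Φ.standard_linearIndependent hξ h0)
    (by rw [Φ.finrank_eq, Fintype.card_fin])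

theorem standardBasis_apply (Φ : THSystem K V d) (ξ : V)
    (hξ : ξ ∈ LinearMap.range (Φ.E 0)) (h0 : ξ ≠ 0) (i : Fin (d + 1)) :
    Φ.standardBasis ξ hξ h0 i = Φ.Estar i ξ := by
  simp [standardBasis]

/-- The `i`-th component of the split decomposition,
`U_i = (E*_0 V + ⋯ + E*_i V) ∩ (E_0 V + ⋯ + E_{d-i} V)`, for `0 ≤ i ≤ d`. -/
def splitSpace (Φ : THSystem K V d) (i : ℕ) : Submodule K V :=
  idempotentFlag Φ.Estar i ⊓ idempotentFlag Φ.E (d - i)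

/-- The map `(A - θ_{d-i+1} I)(A* - θ*_i I)`, for `1 ≤ i ≤ d`. -/
noncomputable def splitMap (Φ : THSystem K V d) (i : ℕ) (h1 : 1 ≤ i) (h2 : i ≤ d) :
    Module.End K V :=
  (Φ.A - Φ.eigenvalue ⟨d - i + 1, by omega⟩ • (1 : Module.End K V)) *
    (Φ.Astar - Φ.dualEigenvalue ⟨i, by omega⟩ • (1 : Module.End K V))

theorem splitMap_mem (Φ : THSystem K V d) (i : ℕ) (h1 : 1 ≤ i) (h2 : i ≤ d) {u : V}
    (hu : u ∈ Φ.splitSpace i) : Φ.splitMap i h1 h2 u ∈ Φ.splitSpace i := by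
  obtain ⟨f1, -, f3, -⟩ := Φ.eigenvalue_spec.facts Φ.multFree
  obtain ⟨g1, -, g3, -⟩ := Φ.dualEigenvalue_spec.facts Φ.multFree_star
  obtain ⟨n, rfl⟩ : ∃ n, i = n + 1 := ⟨i - 1, by omega⟩
  obtain ⟨ha, hb⟩ := hu
  have ha1 := idempotentFlag_lower g1 ⟨n + 1, by omega⟩ rfl ha
  have hb1 := idempotentFlag_raise f3 Φ.hess_zero (Φ.dualEigenvalue ⟨n + 1, by omega⟩) hb
  exact ⟨idempotentFlag_raise g3 Φ.hess_star_zero _ ha1, idempotentFlag_lower f1 _ rfl hb1⟩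

theorem splitSpace_le (Φ : THSystem K V d) {ξ : V} (hξ : ξ ∈ LinearMap.range (Φ.E 0))
    (h0 : ξ ≠ 0) (i : ℕ) (hi : i ≤ d) {u : V} (hu : u ∈ Φ.splitSpace i) :
    ∃ c : K, c • aeval Φ.Astar (etaPoly Φ.dualEigenvalue (d - i)) ξ = u := by
  obtain ⟨-, -, -, -, g5, -⟩ := Φ.dualEigenvalue_spec.facts Φ.multFree_star
  obtain ⟨q, hq, rfl⟩ : ∃ q : K[X], q.natDegree ≤ d - i ∧ aeval Φ.Astar q ξ = u := by
    refine idempotentFlag_induction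
      (P := fun u => ∃ q : K[X], q.natDegree ≤ d - i ∧ aeval Φ.Astar q ξ = u) ?_ ?_ ?_ hu.2
    · intro j hj v
      obtain ⟨q, hq, h⟩ := Φ.exists_poly hξ h0 j j.2 _ ⟨v, rfl⟩
      exact ⟨q, by omega, h⟩
    · exact ⟨0, by simp, by simp⟩
    · rintro _ _ ⟨q, hq, rfl⟩ ⟨r, hr, rfl⟩
      exact ⟨q + r, (natDegree_add_le _ _).trans (max_le hq hr), by simp⟩
  have hroot : ∀ k : Fin (d + 1), i < k → q.eval (Φ.dualEigenvalue k) = 0 := by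
    intro k hk
    have : Φ.Estar k (aeval Φ.Astar q ξ) = 0 := by
      refine idempotentFlag_induction (P := fun u => Φ.Estar k u = 0) ?_ (by simp) ?_ hu.1
      · intro j hj v
        refine g5 k j v fun h => ?_
        subst h
        omega
      · intro v w hv hw
        simp [hv, hw]
    rw [Estar_aeval] at this
    exact (smul_eq_zero.1 this).resolve_right (Φ.Estar_ne_zero hξ h0 k)
  have hdvd : etaPoly Φ.dualEigenvalue (d - i) ∣ q := by
    refine Finset.prod_dvd_of_coprime ?_ ?_
    · intro a _ b _ hab
      refine isCoprime_X_sub_C_of_isUnit_sub (IsUnit.mk0 _ (sub_ne_zero.2 fun h => hab ?_))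
      exact Fin.rev_injective (Φ.dualEigenvalue_spec.1 h)
    · intro a ha
      rw [dvd_iff_isRoot]
      refine hroot _ ?_
      have h3 : (a : ℕ) < d - i := by simpa using ha
      rw [Fin.val_rev]
      omega
  have hmon : (etaPoly Φ.dualEigenvalue (d - i)).Monic :=
    monic_prod_of_monic _ _ fun _ _ => monic_X_sub_C _
  have hdeg : (etaPoly Φ.dualEigenvalue (d - i)).natDegree = d - i := by
    rw [etaPoly, natDegree_prod_of_monic _ _ fun _ _ => monic_X_sub_C _]
    simp [Fin.card_filter_val_lt]
    omega
  have := eq_leadingCoeff_mul_of_monic_of_dvd_of_natDegree_le hmon hdvd (by omega)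
  refine ⟨q.leadingCoeff, ?_⟩
  conv_rhs => rw [this]
  simp

theorem splitSpace_mem (Φ : THSystem K V d) {ξ : V} (hξ : ξ ∈ LinearMap.range (Φ.E 0))
    (h0 : ξ ≠ 0) (i : ℕ) (hi : i ≤ d) :
    aeval Φ.Astar (etaPoly Φ.dualEigenvalue (d - i)) ξ ∈ Φ.splitSpace i ∧
      aeval Φ.Astar (etaPoly Φ.dualEigenvalue (d - i)) ξ ≠ 0 := by
  obtain ⟨-, -, f3, -⟩ := Φ.eigenvalue_spec.facts Φ.multFree
  obtain ⟨-, -, g3, -⟩ := Φ.dualEigenvalue_spec.facts Φ.multFree_star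
  refine ⟨⟨?_, ?_⟩, ?_⟩
  · rw [← g3 (aeval Φ.Astar (etaPoly Φ.dualEigenvalue (d - i)) ξ)]
    refine Submodule.sum_mem _ fun k _ => ?_
    by_cases hk : (k : ℕ) ≤ i
    · exact mem_idempotentFlag _ k hk _
    · rw [Estar_aeval, etaPoly, eval_prod,
        Finset.prod_eq_zero (i := k.rev) (by simp; omega) (by simp), zero_smul]
      exact Submodule.zero_mem _
  · have hpow : ∀ n : ℕ, (Φ.Astar ^ n) ξ ∈ idempotentFlag Φ.E n := by
      intro n
      induction n with
      | zero =>
        obtain ⟨v, rfl⟩ := hξ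
        exact mem_idempotentFlag Φ.E 0 le_rfl v
      | succ n ih =>
        have := idempotentFlag_raise f3 Φ.hess_zero 0 ih
        rw [pow_succ']
        simpa using this
    have hmono : ∀ m n : ℕ, m ≤ n → idempotentFlag Φ.E m ≤ idempotentFlag Φ.E n := by
      intro m n hmn u hu
      exact idempotentFlag_induction (P := fun u => u ∈ idempotentFlag Φ.E n)
        (fun j hj v => mem_idempotentFlag Φ.E j (hj.trans hmn) v) (Submodule.zero_mem _)
        (fun v w => Submodule.add_mem _) hu
    have hdeg : (etaPoly Φ.dualEigenvalue (d - i)).natDegree ≤ d - i := by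
      rw [etaPoly, natDegree_prod_of_monic _ _ fun _ _ => monic_X_sub_C _]
      simp [Fin.card_filter_val_lt]
    rw [aeval_eq_sum_range, LinearMap.sum_apply]
    refine Submodule.sum_mem _ fun n hn => ?_
    have hn1 : n < (etaPoly Φ.dualEigenvalue (d - i)).natDegree + 1 := by simpa using hn
    exact Submodule.smul_mem _ _ (hmono n _ (by omega) (hpow n))
  · intro h
    have h3 := congrArg (Φ.Estar ⟨i, by omega⟩) h
    rw [Estar_aeval, map_zero] at h3
    refine (smul_ne_zero ?_ (Φ.Estar_ne_zero hξ h0 _)) h3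
    rw [etaPoly, eval_prod, Finset.prod_ne_zero_iff]
    intro a ha
    have h4 : (a : ℕ) < d - i := by simpa using ha
    rw [eval_sub, eval_X, eval_C, sub_ne_zero]
    intro h5
    have h6 := congrArg Fin.val (Φ.dualEigenvalue_spec.1 h5)
    rw [Fin.val_rev] at h6
    simp at h6
    omega

/-- On `U_i` the map `(A - θ_{d-i+1} I)(A* - θ*_i I)` is multiplication by a unique scalar. -/
theorem existsUnique_split (Φ : THSystem K V d) (i : ℕ) (h1 : 1 ≤ i) (h2 : i ≤ d) :
    ∃! c : K, ∀ u ∈ Φ.splitSpace i, Φ.splitMap i h1 h2 u = c • u := by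
  obtain ⟨f1, -, -, -, -, f6⟩ := Φ.eigenvalue_spec.facts Φ.multFree
  obtain ⟨v, hv⟩ : ∃ v, Φ.E 0 v ≠ 0 := by
    by_contra! hcon
    exact f6 0 (LinearMap.ext fun x => by simpa using hcon x)
  obtain ⟨hm, hne⟩ := Φ.splitSpace_mem ⟨v, rfl⟩ hv i h2
  obtain ⟨c, hc⟩ := Φ.splitSpace_le ⟨v, rfl⟩ hv i h2 (Φ.splitMap_mem i h1 h2 hm)
  refine ⟨c, ?_, ?_⟩
  · intro u hu
    obtain ⟨b, rfl⟩ := Φ.splitSpace_le ⟨v, rfl⟩ hv i h2 hu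
    rw [map_smul, ← hc, smul_comm]
  · intro c₁ h
    have h3 := h _ hm
    rw [← hc] at h3
    exact (smul_left_injective K hne h3).symm

/-- The split sequence: for `1 ≤ i ≤ d`, `φ_i` is the eigenvalue of
`(A - θ_{d-i+1} I)(A* - θ*_i I)` on `U_i`. By convention it is `0` for the other indices. -/
noncomputable def split (Φ : THSystem K V d) (i : ℕ) : K :=
  if h : 1 ≤ i ∧ i ≤ d then (Φ.existsUnique_split i h.1 h.2).choose else 0

/-- The scalars `ℓ_i = η*_d(θ*_0) / (τ*_i(θ*_i) η*_{d-i}(θ*_i))`. -/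
noncomputable def ell (Φ : THSystem K V d) (i : Fin (d + 1)) : K :=
  (etaPoly Φ.dualEigenvalue d).eval (Φ.dualEigenvalue 0) /
    ((tauPoly Φ.dualEigenvalue i).eval (Φ.dualEigenvalue i) *
      (etaPoly Φ.dualEigenvalue (d - i)).eval (Φ.dualEigenvalue i))

/-- The two-variable polynomial `p = ∑_{h=0}^d η_h(λ) τ*_h(μ) / (φ_1 φ_2 ⋯ φ_h)` in `K[λ, μ]`,
where `λ` is the variable `0` and `μ` is the variable `1`. -/
noncomputable def twoVarPoly (Φ : THSystem K V d) : MvPolynomial (Fin 2) K :=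
  ∑ h ∈ Finset.range (d + 1),
    MvPolynomial.C (∏ i ∈ Finset.Icc 1 h, Φ.split i)⁻¹ *
      (aeval (MvPolynomial.X 0 : MvPolynomial (Fin 2) K) (etaPoly Φ.eigenvalue h) *
        aeval (MvPolynomial.X 1 : MvPolynomial (Fin 2) K) (tauPoly Φ.dualEigenvalue h))

/-- The polynomial `p(λ, c)` in `K[λ]`, for a scalar `c`. -/
noncomputable def twoVarPolyAt (Φ : THSystem K V d) (c : K) : K[X] :=
  MvPolynomial.aeval ![(X : K[X]), C c] Φ.twoVarPoly

/-- The polynomials `s_0, …, s_{d+1}`: the polynomials of the Hessenberg matrix that represents `A`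
with respect to the standard basis `E*_0 ξ, …, E*_d ξ`. -/
noncomputable def sPoly (Φ : THSystem K V d) (ξ : V)
    (hξ : ξ ∈ LinearMap.range (Φ.E 0)) (h0 : ξ ≠ 0) : Fin (d + 2) → K[X] :=
  hessPoly (LinearMap.toMatrix (Φ.standardBasis ξ hξ h0) (Φ.standardBasis ξ hξ h0) Φ.A)

/-- The normalized polynomials: `t_i = s_i / ℓ_i` for `0 ≤ i ≤ d`, and `t_{d+1} = s_{d+1}`. -/
noncomputable def tPoly (Φ : THSystem K V d) (ξ : V)
    (hξ : ξ ∈ LinearMap.range (Φ.E 0)) (h0 : ξ ≠ 0) : Fin (d + 2) → K[X] :=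
  Fin.snoc (α := fun _ => K[X])
    (fun i : Fin (d + 1) => C (Φ.ell i)⁻¹ * Φ.sPoly ξ hξ h0 i.castSucc)
    (Φ.sPoly ξ hξ h0 (Fin.last (d + 1)))

end THSystem

/-! The recursion for the `s_i` says that a linear map `V → K[λ]` sending `E*_i ξ` to `s_i` turns
`A` into multiplication by `λ`, except for a defect `c_H⁻¹ s_{d+1}` at the last basis vector. The
proof builds such a map, `polyMap`, from the closed formula and then appeals to uniqueness of the
recursion (`eq_hessPoly`).

The map is defined on the split basis `w_h = η*_{d-h}(A*) ξ`, where `A` is lower bidiagonal: `A w_h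
= θ_{d-h} w_h + φ_{h+1} w_{h+1}` (`A_splitVec`). The polynomials `η_h / (φ_1 ⋯ φ_h)` obey the same
two-term rule under multiplication by `λ`, so sending `w_h` to a fixed multiple of them intertwines
the two actions for `h < d`. At `w_d = ξ` what is left over is a multiple of `η_{d+1} = ∏ (λ -
θ_i)`.

The bridge to the standard basis is `sum_splitVec`: `∑ τ*_h(θ*_i) w_h` is a nonzero multiple of
`E*_i ξ`, so the image of `E*_i ξ` is `ℓ_i p(λ, θ*_i)`. Since `τ*_d(θ*_j) = 0` for `j < d`, the
vector `w_d` enters only `E*_d ξ`, and the defect appears only there. Its constant is identified as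
`c_H⁻¹` by `subdiagProd_mul_eval`. -/

/-! ### Recursions and zeros of the products `τ_i` and `η_i` -/

theorem tauPoly_succ {K : Type*} [Field K] {d : ℕ} (θ : Fin (d + 1) → K) (i : ℕ)
    (hi : i < d + 1) : tauPoly θ (i + 1) = tauPoly θ i * (X - C (θ ⟨i, hi⟩)) := by
  have e : (Finset.univ.filter fun h : Fin (d + 1) => h.val < i + 1) =
      insert ⟨i, hi⟩ (Finset.univ.filter fun h : Fin (d + 1) => h.val < i) := by
    ext h
    simp [Fin.ext_iff]
    omega
  rw [tauPoly, tauPoly, e, Finset.prod_insert (by simp), mul_comm]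

/-- Reversing the sequence lets the facts on `τ` be transferred to `η`. -/
theorem etaPoly_eq_tauPoly {K : Type*} [Field K] {d : ℕ} (θ : Fin (d + 1) → K) (i : ℕ) :
    etaPoly θ i = tauPoly (fun h => θ h.rev) i := rfl

theorem etaPoly_succ {K : Type*} [Field K] {d : ℕ} (θ : Fin (d + 1) → K) (i : ℕ)
    (hi : i < d + 1) :
    etaPoly θ (i + 1) = etaPoly θ i * (X - C (θ ⟨d - i, by omega⟩)) := by
  rw [etaPoly_eq_tauPoly, tauPoly_succ _ i hi, ← etaPoly_eq_tauPoly]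
  congr 4
  ext
  simp [Fin.val_rev]

theorem tauPoly_zero {K : Type*} [Field K] {d : ℕ} (θ : Fin (d + 1) → K) : tauPoly θ 0 = 1 := by
  simp [tauPoly]

theorem etaPoly_zero {K : Type*} [Field K] {d : ℕ} (θ : Fin (d + 1) → K) : etaPoly θ 0 = 1 := by
  simp [etaPoly]

theorem etaPoly_card {K : Type*} [Field K] {d : ℕ} (θ : Fin (d + 1) → K) :
    etaPoly θ (d + 1) = ∏ i, (X - C (θ i)) := by
  rw [etaPoly, Finset.filter_true_of_mem fun h _ => h.2]
  exact Fintype.prod_equiv Fin.revPerm _ _ fun _ => rfl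

theorem eval_tauPoly_eq_zero {K : Type*} [Field K] {d : ℕ} (θ : Fin (d + 1) → K) {h : ℕ}
    (i : Fin (d + 1)) (hi : (i : ℕ) < h) : (tauPoly θ h).eval (θ i) = 0 := by
  rw [tauPoly, eval_prod]
  exact Finset.prod_eq_zero (i := i) (by simpa using hi) (by simp)

theorem eval_tauPoly_ne_zero {K : Type*} [Field K] {d : ℕ} {θ : Fin (d + 1) → K}
    (hθ : Function.Injective θ) {h : ℕ} (i : Fin (d + 1)) (hi : h ≤ i) :
    (tauPoly θ h).eval (θ i) ≠ 0 := by
  rw [tauPoly, eval_prod, Finset.prod_ne_zero_iff]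
  intro a ha
  have ha : (a : ℕ) < h := by simpa using ha
  rw [eval_sub, eval_X, eval_C, sub_ne_zero]
  intro e
  have := congrArg Fin.val (hθ e)
  omega

theorem eval_etaPoly_eq_zero {K : Type*} [Field K] {d : ℕ} (θ : Fin (d + 1) → K) {h : ℕ}
    (i : Fin (d + 1)) (hi : d - h < i) : (etaPoly θ h).eval (θ i) = 0 := by
  have := eval_tauPoly_eq_zero (fun h => θ h.rev) (h := h) i.rev (by rw [Fin.val_rev]; omega)
  simpa [etaPoly_eq_tauPoly] using this

theorem eval_etaPoly_ne_zero {K : Type*} [Field K] {d : ℕ} {θ : Fin (d + 1) → K}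
    (hθ : Function.Injective θ) {h : ℕ} (i : Fin (d + 1)) (hi : h + i ≤ d) :
    (etaPoly θ h).eval (θ i) ≠ 0 := by
  have := eval_tauPoly_ne_zero (hθ.comp Fin.rev_injective) (h := h) i.rev
    (by rw [Fin.val_rev]; omega)
  simpa [etaPoly_eq_tauPoly, Function.comp_def] using this

/-! ### Uniqueness of the Hessenberg recursion -/

/-- The defining equations of the polynomials of a Hessenberg matrix determine them. -/
theorem eq_hessPoly {K : Type*} [Field K] {d : ℕ}
    {H : Matrix (Fin (d + 1)) (Fin (d + 1)) K} (hH : IsHessenberg H) (f : Fin (d + 2) → K[X])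
    (h0 : f 0 = 1)
    (h1 : ∀ j : Fin (d + 1), (j : ℕ) < d →
      X * f j.castSucc = ∑ i : Fin (d + 1), C (H i j) * f i.castSucc)
    (h2 : X * f (Fin.last d).castSucc =
      C (subdiagProd H)⁻¹ * f (Fin.last (d + 1)) +
        ∑ i : Fin (d + 1), C (H i (Fin.last d)) * f i.castSucc) :
    hessPoly H = f := by
  obtain ⟨g0, g1, g2⟩ := hessPoly_spec H hH
  have key : ∀ n : ℕ, ∀ hn : n < d + 1,
      hessPoly H (Fin.castSucc ⟨n, hn⟩) = f (Fin.castSucc ⟨n, hn⟩) := by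
    intro n
    induction n using Nat.strong_induction_on with
    | _ n ih =>
      intro hn
      rcases n with _ | n
      · exact g0.trans h0.symm
      · have a1 := g1 ⟨n, by omega⟩ (by simp; omega)
        have a2 := h1 ⟨n, by omega⟩ (by simp; omega)
        -- The recursion in `hessPoly_spec` stops at `i = j + 1`; the Hessenberg zeros allow the sum
        -- to run over all `i`, as in `h1`.
        rw [ih n (by omega) (by omega), a2, Finset.sum_filter_of_ne] at a1
        · rw [← Finset.add_sum_erase _ _ (Finset.mem_univ ⟨n + 1, hn⟩),
            ← Finset.add_sum_erase _ (fun i : Fin (d + 1) => C (H i ⟨n, _⟩) *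
              hessPoly H i.castSucc) (Finset.mem_univ ⟨n + 1, hn⟩)] at a1
          -- Away from `i = n + 1` both sums agree: smaller indices by induction, larger ones
          -- because the entry is zero. The nonzero subdiagonal entry then cancels.
          have a3 : ∑ i ∈ Finset.univ.erase (⟨n + 1, hn⟩ : Fin (d + 1)),
                C (H i ⟨n, by omega⟩) * f i.castSucc =
              ∑ i ∈ Finset.univ.erase (⟨n + 1, hn⟩ : Fin (d + 1)),
                C (H i ⟨n, by omega⟩) * hessPoly H i.castSucc := by
            refine Finset.sum_congr rfl fun i hi => ?_
            have hi : (i : ℕ) ≠ n + 1 := fun h => (Finset.mem_erase.1 hi).1 (Fin.ext h)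
            by_cases hin : n + 1 < (i : ℕ)
            · rw [hH.1 i ⟨n, by omega⟩ hin]
              simp
            · rw [ih i (by omega) i.2]
          rw [a3] at a1
          have hne : (C (H ⟨n + 1, hn⟩ ⟨n, by omega⟩) : K[X]) ≠ 0 :=
            C_ne_zero.2 (hH.2 _ _ rfl)
          exact (mul_left_cancel₀ hne (add_right_cancel a1)).symm
        · intro i _ hi
          by_contra hcon
          refine hi ?_
          rw [hH.1 i ⟨n, by omega⟩ (by simpa using hcon)]
          simp
  funext i
  induction i using Fin.lastCases with
  | cast i => exact key i i.2
  | last =>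
    have hc : (C (subdiagProd H)⁻¹ : K[X]) ≠ 0 :=
      C_ne_zero.2 (inv_ne_zero (Finset.prod_ne_zero_iff.2 fun i _ => hH.2 _ _ (by simp)))
    have e : ∀ i : Fin (d + 1), hessPoly H i.castSucc = f i.castSucc := fun i => key i i.2
    simp only [e] at g2
    exact mul_left_cancel₀ hc (add_right_cancel (g2.symm.trans h2))

/-! ### The split basis, and the actions of `A` and `A*` on it -/

namespace THSystem

variable {K V : Type*} [Field K] [AddCommGroup V] [Module K V] {d : ℕ}

/-- The vector `η*_{d-i}(A*) ξ`, which spans `U_i`. -/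
noncomputable def splitVec (Φ : THSystem K V d) (ξ : V) (i : ℕ) : V :=
  aeval Φ.Astar (etaPoly Φ.dualEigenvalue (d - i)) ξ

theorem splitVec_last (Φ : THSystem K V d) (ξ : V) : Φ.splitVec ξ d = ξ := by
  simp [splitVec, etaPoly_zero]

theorem Estar_splitVec (Φ : THSystem K V d) (ξ : V) (i : ℕ) (k : Fin (d + 1)) :
    Φ.Estar k (Φ.splitVec ξ i) =
      (etaPoly Φ.dualEigenvalue (d - i)).eval (Φ.dualEigenvalue k) • Φ.Estar k ξ :=
  Φ.Estar_aeval k _ ξ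

/-- The factor that `η*_{d-i}` has beyond `η*_{d-i-1}` is `λ - θ*_{i+1}`. -/
theorem Astar_splitVec_succ (Φ : THSystem K V d) (ξ : V) (i : ℕ) (hi : i < d) :
    Φ.Astar (Φ.splitVec ξ (i + 1)) =
      Φ.dualEigenvalue ⟨i + 1, by omega⟩ • Φ.splitVec ξ (i + 1) + Φ.splitVec ξ i := by
  have e := etaPoly_succ Φ.dualEigenvalue (d - (i + 1)) (by omega)
  have e1 : d - (i + 1) + 1 = d - i := by omega
  have e2 : (⟨d - (d - (i + 1)), by omega⟩ : Fin (d + 1)) = ⟨i + 1, by omega⟩ :=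
    Fin.ext (by simp; omega)
  rw [e1, e2, mul_comm] at e
  simp only [splitVec, e]
  simp

/-- The roots of `η*_d` are all `θ*_k` with `k ≠ 0`, so only the component in `E*_0 V` survives. -/
theorem Astar_splitVec_zero (Φ : THSystem K V d) (ξ : V) :
    Φ.Astar (Φ.splitVec ξ 0) = Φ.dualEigenvalue 0 • Φ.splitVec ξ 0 := by
  obtain ⟨g1, -, g3, -⟩ := Φ.dualEigenvalue_spec.facts Φ.multFree_star
  have e : Φ.splitVec ξ 0 = Φ.Estar 0 (Φ.splitVec ξ 0) := by
    conv_lhs => rw [← g3 (Φ.splitVec ξ 0)]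
    refine Finset.sum_eq_single _ (fun k _ hk => ?_) (by simp)
    rw [Estar_splitVec, eval_etaPoly_eq_zero _ _ ?_, zero_smul]
    have : (k : ℕ) ≠ 0 := fun h => hk (Fin.ext h)
    omega
  rw [e, g1]

/-- This is the definition of `φ_{i+1}` evaluated at `w_{i+1}`: the factor `A* - θ*_{i+1}` sends
`w_{i+1}` to `w_i`, leaving `(A - θ_{d-i}) w_i`. -/
theorem A_splitVec (Φ : THSystem K V d) {ξ : V} (hξ : ξ ∈ LinearMap.range (Φ.E 0))
    (h0 : ξ ≠ 0) (i : ℕ) (hi : i < d) :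
    Φ.A (Φ.splitVec ξ i) = Φ.eigenvalue ⟨d - i, by omega⟩ • Φ.splitVec ξ i +
      Φ.split (i + 1) • Φ.splitVec ξ (i + 1) := by
  have h1 : 1 ≤ i + 1 ∧ i + 1 ≤ d := by omega
  have hs := (Φ.existsUnique_split (i + 1) h1.1 h1.2).choose_spec.1 (Φ.splitVec ξ (i + 1))
    (Φ.splitSpace_mem hξ h0 (i + 1) h1.2).1
  have e : (⟨d - (i + 1) + 1, by omega⟩ : Fin (d + 1)) = ⟨d - i, by omega⟩ :=
    Fin.ext (by simp; omega)
  rw [split, dif_pos h1, ← hs, splitMap, e]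
  simp [Φ.Astar_splitVec_succ ξ i hi]

theorem A_splitVec_last (Φ : THSystem K V d) {ξ : V} (hξ : ξ ∈ LinearMap.range (Φ.E 0)) :
    Φ.A (Φ.splitVec ξ d) = Φ.eigenvalue 0 • Φ.splitVec ξ d := by
  obtain ⟨f1, -⟩ := Φ.eigenvalue_spec.facts Φ.multFree
  obtain ⟨v, rfl⟩ := hξ
  rw [splitVec_last, f1]

/-- The expansion of `E*_i ξ`, up to a nonzero scalar, in the vectors `η*_{d-h}(A*) ξ`. -/
theorem sum_splitVec (Φ : THSystem K V d) (ξ : V) (i : Fin (d + 1)) :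
    ∑ h ∈ Finset.range (d + 1),
        (tauPoly Φ.dualEigenvalue h).eval (Φ.dualEigenvalue i) • Φ.splitVec ξ h =
      ((tauPoly Φ.dualEigenvalue i).eval (Φ.dualEigenvalue i) *
        (etaPoly Φ.dualEigenvalue (d - i)).eval (Φ.dualEigenvalue i)) • Φ.Estar i ξ := by
  obtain ⟨-, -, -, g4, -⟩ := Φ.dualEigenvalue_spec.facts Φ.multFree_star
  -- A truncated sum fails to be an eigenvector of `A*` by one telescoping term. At `n = d` that
  -- term carries `τ*_{d+1}(θ*_i) = 0`.
  have partialSum : ∀ n ≤ d, Φ.Astar (∑ h ∈ Finset.range (n + 1),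
        (tauPoly Φ.dualEigenvalue h).eval (Φ.dualEigenvalue i) • Φ.splitVec ξ h) =
      Φ.dualEigenvalue i • (∑ h ∈ Finset.range (n + 1),
        (tauPoly Φ.dualEigenvalue h).eval (Φ.dualEigenvalue i) • Φ.splitVec ξ h) -
        (tauPoly Φ.dualEigenvalue (n + 1)).eval (Φ.dualEigenvalue i) • Φ.splitVec ξ n := by
    intro n hn
    induction n with
    | zero =>
      have := tauPoly_succ Φ.dualEigenvalue 0 (by omega)
      rw [zero_add, this]
      simp [tauPoly_zero, Astar_splitVec_zero, sub_smul]
    | succ n ih =>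
      rw [Finset.sum_range_succ, map_add, ih (by omega), map_smul,
        Astar_splitVec_succ _ _ _ (by omega),
        tauPoly_succ Φ.dualEigenvalue (n + 1) (by omega), eval_mul]
      simp only [eval_sub, eval_X, eval_C]
      module
  have hA := partialSum d le_rfl
  rw [eval_tauPoly_eq_zero _ i i.2, zero_smul, sub_zero] at hA
  -- The full sum is thus fixed by `E*_i`. Applying `E*_i` termwise leaves only `h = i`:
  -- `η*_{d-h}(θ*_i)` vanishes for `h < i` and `τ*_h(θ*_i)` for `h > i`.
  rw [← g4 i _ hA, map_sum, Finset.sum_eq_single (i : ℕ)]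
  · rw [map_smul, Estar_splitVec, smul_smul]
  · intro h hh hne
    rw [map_smul, Estar_splitVec, smul_smul]
    rcases lt_or_gt_of_ne hne with hlt | hgt
    · rw [eval_etaPoly_eq_zero _ i (by omega), mul_zero, zero_smul]
    · rw [eval_tauPoly_eq_zero _ i hgt, zero_mul, zero_smul]
  · intro h
    exact absurd (Finset.mem_range.2 i.2) h

theorem ellDenom_ne_zero (Φ : THSystem K V d) (i : Fin (d + 1)) :
    (tauPoly Φ.dualEigenvalue i).eval (Φ.dualEigenvalue i) *
        (etaPoly Φ.dualEigenvalue (d - i)).eval (Φ.dualEigenvalue i) ≠ 0 :=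
  mul_ne_zero (eval_tauPoly_ne_zero Φ.dualEigenvalue_spec.1 i le_rfl)
    (eval_etaPoly_ne_zero Φ.dualEigenvalue_spec.1 i (by omega))

theorem ell_ne_zero (Φ : THSystem K V d) (i : Fin (d + 1)) : Φ.ell i ≠ 0 :=
  div_ne_zero (eval_etaPoly_ne_zero Φ.dualEigenvalue_spec.1 0 (by simp)) (Φ.ellDenom_ne_zero i)

/-- By `sum_splitVec`, each standard basis vector is a combination of the `w_h`. -/
theorem top_le_span_splitVec (Φ : THSystem K V d) {ξ : V} (hξ : ξ ∈ LinearMap.range (Φ.E 0))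
    (h0 : ξ ≠ 0) :
    ⊤ ≤ Submodule.span K (Set.range fun i : Fin (d + 1) => Φ.splitVec ξ i) := by
  rw [← (Φ.standardBasis ξ hξ h0).span_eq, Submodule.span_le]
  rintro _ ⟨i, rfl⟩
  rw [standardBasis_apply]
  refine (Submodule.smul_mem_iff _ (Φ.ellDenom_ne_zero i)).1 ?_
  rw [← sum_splitVec]
  refine Submodule.sum_mem _ fun h hh => Submodule.smul_mem _ _ (Submodule.subset_span ?_)
  exact ⟨⟨h, Finset.mem_range.1 hh⟩, rfl⟩

/-- The basis `η*_d(A*) ξ, …, η*_0(A*) ξ` of `V`, adapted to the split decomposition. -/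
noncomputable def splitBasis (Φ : THSystem K V d) {ξ : V} (hξ : ξ ∈ LinearMap.range (Φ.E 0))
    (h0 : ξ ≠ 0) : Module.Basis (Fin (d + 1)) K V :=
  basisOfTopLeSpanOfCardEqFinrank _ (Φ.top_le_span_splitVec hξ h0)
    (by rw [Φ.finrank_eq, Fintype.card_fin])

theorem splitBasis_apply (Φ : THSystem K V d) {ξ : V} (hξ : ξ ∈ LinearMap.range (Φ.E 0))
    (h0 : ξ ≠ 0) (i : Fin (d + 1)) : Φ.splitBasis hξ h0 i = Φ.splitVec ξ i := by
  simp [splitBasis]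

/-! ### The Hessenberg matrix and its subdiagonal in terms of the split sequence -/

/-- The matrix that represents `A` with respect to the standard basis. -/
noncomputable def standardMatrix (Φ : THSystem K V d) {ξ : V}
    (hξ : ξ ∈ LinearMap.range (Φ.E 0)) (h0 : ξ ≠ 0) : Matrix (Fin (d + 1)) (Fin (d + 1)) K :=
  LinearMap.toMatrix (Φ.standardBasis ξ hξ h0) (Φ.standardBasis ξ hξ h0) Φ.A

theorem sum_standardMatrix (Φ : THSystem K V d) {ξ : V}
    (hξ : ξ ∈ LinearMap.range (Φ.E 0)) (h0 : ξ ≠ 0) (j : Fin (d + 1)) :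
    ∑ i, Φ.standardMatrix hξ h0 i j • Φ.Estar i ξ = Φ.A (Φ.Estar j ξ) := by
  have := (Φ.standardBasis ξ hξ h0).sum_repr (Φ.A (Φ.Estar j ξ))
  simpa [standardMatrix, LinearMap.toMatrix_apply, standardBasis_apply] using this

theorem Estar_A_Estar (Φ : THSystem K V d) {ξ : V}
    (hξ : ξ ∈ LinearMap.range (Φ.E 0)) (h0 : ξ ≠ 0) (i j : Fin (d + 1)) :
    Φ.Estar i (Φ.A (Φ.Estar j ξ)) = Φ.standardMatrix hξ h0 i j • Φ.Estar i ξ := by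
  obtain ⟨g1, -, -, g4, g5, -⟩ := Φ.dualEigenvalue_spec.facts Φ.multFree_star
  rw [← Φ.sum_standardMatrix hξ h0 j, map_sum, Finset.sum_eq_single i]
  · rw [map_smul, g4 i _ (g1 i ξ)]
  · intro k _ hk
    rw [map_smul, g5 i k _ hk, smul_zero]
  · simp

/-- The map `E*_i A E*_j` kills every standard basis vector except `E*_j ξ`, which it sends to
`H_{ij} E*_i ξ`; so it vanishes exactly when `H_{ij}` does. -/
theorem isHessenberg_standardMatrix (Φ : THSystem K V d) {ξ : V}
    (hξ : ξ ∈ LinearMap.range (Φ.E 0)) (h0 : ξ ≠ 0) : IsHessenberg (Φ.standardMatrix hξ h0) := by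
  obtain ⟨g1, -, -, g4, g5, -⟩ := Φ.dualEigenvalue_spec.facts Φ.multFree_star
  refine ⟨fun i j hij => ?_, fun i j hij hz => Φ.hess_star_ne_zero i j hij ?_⟩
  · have h := congrArg (fun T : Module.End K V => T ξ) (Φ.hess_star_zero i j hij)
    simp only [Module.End.mul_apply, LinearMap.zero_apply, Φ.Estar_A_Estar hξ h0] at h
    exact (smul_eq_zero.1 h).resolve_right (Φ.Estar_ne_zero hξ h0 i)
  · refine (Φ.standardBasis ξ hξ h0).ext fun k => ?_
    rw [standardBasis_apply, Module.End.mul_apply, Module.End.mul_apply, LinearMap.zero_apply]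
    by_cases hk : k = j
    · subst hk
      rw [g4 k _ (g1 k ξ), Φ.Estar_A_Estar hξ h0, hz, zero_smul]
    · rw [g5 j k ξ hk, map_zero, map_zero]

/-- Both sides are the coefficient of `E*_{i+1} ξ` in `A w_i`, computed in the standard basis and
from `A_splitVec`. -/
theorem standardMatrix_mul_eval (Φ : THSystem K V d) {ξ : V}
    (hξ : ξ ∈ LinearMap.range (Φ.E 0)) (h0 : ξ ≠ 0) (i : ℕ) (hi : i < d) :
    Φ.standardMatrix hξ h0 ⟨i + 1, by omega⟩ ⟨i, by omega⟩ *
        (etaPoly Φ.dualEigenvalue (d - i)).eval (Φ.dualEigenvalue ⟨i, by omega⟩) =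
      Φ.split (i + 1) * (etaPoly Φ.dualEigenvalue (d - (i + 1))).eval
        (Φ.dualEigenvalue ⟨i + 1, by omega⟩) := by
  obtain ⟨-, -, g3, -⟩ := Φ.dualEigenvalue_spec.facts Φ.multFree_star
  have h1 := congrArg (Φ.Estar ⟨i + 1, by omega⟩) (Φ.A_splitVec hξ h0 i hi)
  rw [map_add, map_smul, map_smul, Estar_splitVec, Estar_splitVec,
    eval_etaPoly_eq_zero _ _ (by simp; omega), zero_smul, smul_zero, zero_add] at h1
  -- In `w_i = ∑ E*_k w_i` only `k = i` contributes: for `k > i` the component is zero, and for `k <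
  -- i` the entry `H_{i+1,k}` is.
  conv_lhs at h1 => rw [← g3 (Φ.splitVec ξ i)]
  rw [map_sum, map_sum, Finset.sum_eq_single ⟨i, by omega⟩ _ (by simp), Estar_splitVec, map_smul,
    map_smul, Φ.Estar_A_Estar hξ h0, smul_smul, smul_smul] at h1
  · rw [mul_comm]
    exact smul_left_injective K (Φ.Estar_ne_zero hξ h0 _) h1
  · intro k _ hk
    have hk : (k : ℕ) ≠ i := fun h => hk (Fin.ext h)
    rw [Estar_splitVec, map_smul, map_smul, Φ.Estar_A_Estar hξ h0]
    rcases lt_or_gt_of_ne hk with hlt | hgt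
    · rw [(Φ.isHessenberg_standardMatrix hξ h0).1 _ _ (by simp; omega), zero_smul, smul_zero]
    · rw [eval_etaPoly_eq_zero _ _ (by omega), zero_smul]

theorem split_ne_zero (Φ : THSystem K V d) {ξ : V}
    (hξ : ξ ∈ LinearMap.range (Φ.E 0)) (h0 : ξ ≠ 0) (i : ℕ) (hi : i < d) :
    Φ.split (i + 1) ≠ 0 := by
  intro h
  have e := Φ.standardMatrix_mul_eval hξ h0 i hi
  rw [h, zero_mul] at e
  exact mul_ne_zero ((Φ.isHessenberg_standardMatrix hξ h0).2 _ _ rfl)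
    (eval_etaPoly_ne_zero Φ.dualEigenvalue_spec.1 _ (by simp; omega)) e

/-- With `e_i = η*_{d-i}(θ*_i)`, the relations `H_{i+1,i} e_i = φ_{i+1} e_{i+1}` telescope, and `e_d
= 1`. -/
theorem subdiagProd_mul_eval (Φ : THSystem K V d) {ξ : V}
    (hξ : ξ ∈ LinearMap.range (Φ.E 0)) (h0 : ξ ≠ 0) :
    subdiagProd (Φ.standardMatrix hξ h0) *
        (etaPoly Φ.dualEigenvalue d).eval (Φ.dualEigenvalue 0) =
      ∏ i ∈ Finset.Icc 1 d, Φ.split i := by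
  -- Indexing by `ℕ` through `Fin.ofNat` permits induction; the reduction modulo `d + 1` has no
  -- effect on the indices used.
  let e : ℕ → K := fun i =>
    (etaPoly Φ.dualEigenvalue (d - i)).eval (Φ.dualEigenvalue (Fin.ofNat (d + 1) i))
  let H : ℕ → K := fun i =>
    Φ.standardMatrix hξ h0 (Fin.ofNat (d + 1) (i + 1)) (Fin.ofNat (d + 1) i)
  have of : ∀ (i : ℕ) (hi : i < d + 1), Fin.ofNat (d + 1) i = ⟨i, hi⟩ := fun i hi =>
    Fin.ext (Nat.mod_eq_of_lt hi)
  have tel : ∀ n ≤ d, (∏ i ∈ Finset.range n, H i) * e 0 =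
      (∏ i ∈ Finset.Icc 1 n, Φ.split i) * e n := by
    intro n hn
    induction n with
    | zero => simp
    | succ n ih =>
      have key := Φ.standardMatrix_mul_eval hξ h0 n (by omega)
      rw [← of n (by omega), ← of (n + 1) (by omega)] at key
      change H n * e n = Φ.split (n + 1) * e (n + 1) at key
      rw [Finset.prod_range_succ, mul_right_comm, ih (by omega), mul_assoc, mul_comm (e n), key,
        Finset.prod_Icc_succ_top (by omega), mul_assoc]
  have hd := tel d le_rfl
  have e0 : e 0 = (etaPoly Φ.dualEigenvalue d).eval (Φ.dualEigenvalue 0) := by simp [e]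
  have ed : e d = 1 := by simp [e, etaPoly_zero]
  rw [e0, ed, mul_one] at hd
  rw [← hd, subdiagProd, Finset.prod_range]
  congr 1
  refine Finset.prod_congr rfl fun i _ => ?_
  simp only [H, of i (by omega), of (i + 1) (by omega)]
  rfl

/-! ### The map to `K[λ]` and its values on the two bases -/

theorem twoVarPolyAt_eq (Φ : THSystem K V d) (c : K) :
    Φ.twoVarPolyAt c = ∑ h ∈ Finset.range (d + 1),
      C ((∏ i ∈ Finset.Icc 1 h, Φ.split i)⁻¹ * (tauPoly Φ.dualEigenvalue h).eval c) *
        etaPoly Φ.eigenvalue h := by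
  have e1 : ∀ q : K[X], MvPolynomial.aeval ![(X : K[X]), C c]
      (aeval (MvPolynomial.X 0 : MvPolynomial (Fin 2) K) q) = q := by
    intro q
    rw [← aeval_algHom_apply]
    simp
  have e2 : ∀ q : K[X], MvPolynomial.aeval ![(X : K[X]), C c]
      (aeval (MvPolynomial.X 1 : MvPolynomial (Fin 2) K) q) = C (q.eval c) := by
    intro q
    rw [← aeval_algHom_apply, MvPolynomial.aeval_X]
    change aeval (algebraMap K K[X] c) q = _
    rw [aeval_algebraMap_apply]
    simp
  rw [twoVarPolyAt, twoVarPoly, map_sum]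
  refine Finset.sum_congr rfl fun h _ => ?_
  rw [map_mul, map_mul, e1, e2, MvPolynomial.aeval_C, C_mul, ← C_eq_algebraMap]
  ring

/-- The `K[λ]`-valued linear map on `V` whose values on the standard basis are the polynomials
`ℓ_i p(λ, θ*_i)`. -/
noncomputable def polyMap (Φ : THSystem K V d) {ξ : V}
    (hξ : ξ ∈ LinearMap.range (Φ.E 0)) (h0 : ξ ≠ 0) : V →ₗ[K] K[X] :=
  (Φ.splitBasis hξ h0).constr K fun i =>
    C ((etaPoly Φ.dualEigenvalue d).eval (Φ.dualEigenvalue 0) *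
      (∏ k ∈ Finset.Icc 1 (i : ℕ), Φ.split k)⁻¹) * etaPoly Φ.eigenvalue i

theorem polyMap_splitVec (Φ : THSystem K V d) {ξ : V}
    (hξ : ξ ∈ LinearMap.range (Φ.E 0)) (h0 : ξ ≠ 0) (i : ℕ) (hi : i ≤ d) :
    Φ.polyMap hξ h0 (Φ.splitVec ξ i) =
      C ((etaPoly Φ.dualEigenvalue d).eval (Φ.dualEigenvalue 0) *
        (∏ k ∈ Finset.Icc 1 i, Φ.split k)⁻¹) * etaPoly Φ.eigenvalue i := by
  have := (Φ.splitBasis hξ h0).constr_basis K (fun i =>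
    C ((etaPoly Φ.dualEigenvalue d).eval (Φ.dualEigenvalue 0) *
      (∏ k ∈ Finset.Icc 1 (i : ℕ), Φ.split k)⁻¹) * etaPoly Φ.eigenvalue i) ⟨i, by omega⟩
  rwa [splitBasis_apply] at this

theorem polyMap_Estar (Φ : THSystem K V d) {ξ : V}
    (hξ : ξ ∈ LinearMap.range (Φ.E 0)) (h0 : ξ ≠ 0) (i : Fin (d + 1)) :
    Φ.polyMap hξ h0 (Φ.Estar i ξ) = C (Φ.ell i) * Φ.twoVarPolyAt (Φ.dualEigenvalue i) := by
  have h := congrArg (Φ.polyMap hξ h0) (Φ.sum_splitVec ξ i)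
  have hN := Φ.ellDenom_ne_zero i
  rw [map_smul, map_sum] at h
  rw [← inv_smul_smul₀ hN (Φ.polyMap hξ h0 (Φ.Estar i ξ)), ← h, twoVarPolyAt_eq,
    Finset.smul_sum, Finset.mul_sum]
  refine Finset.sum_congr rfl fun k hk => ?_
  rw [map_smul, Φ.polyMap_splitVec hξ h0 k (by simpa [Nat.lt_succ_iff] using hk), ell,
    smul_eq_C_mul, smul_eq_C_mul, ← mul_assoc, ← mul_assoc, ← mul_assoc, ← C_mul, ← C_mul, ← C_mul]
  congr 2
  rw [div_eq_mul_inv]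
  ring

/-! ### Intertwining `A` with multiplication by `λ` -/

/-- After cancelling `φ_{i+1} ≠ 0`, this is `θ_{d-i} η_i + η_{i+1} = λ η_i`. -/
theorem polyMap_A_splitVec (Φ : THSystem K V d) {ξ : V}
    (hξ : ξ ∈ LinearMap.range (Φ.E 0)) (h0 : ξ ≠ 0) (i : ℕ) (hi : i < d) :
    Φ.polyMap hξ h0 (Φ.A (Φ.splitVec ξ i)) = X * Φ.polyMap hξ h0 (Φ.splitVec ξ i) := by
  rw [Φ.A_splitVec hξ h0 i hi, map_add, map_smul, map_smul, Φ.polyMap_splitVec hξ h0 i hi.le,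
    Φ.polyMap_splitVec hξ h0 (i + 1) hi, etaPoly_succ _ i (by omega),
    Finset.prod_Icc_succ_top (by omega), smul_eq_C_mul, smul_eq_C_mul,
    ← mul_assoc (C (Φ.split (i + 1))), ← C_mul]
  have e : ∀ c b : K, Φ.split (i + 1) * (c * (b * Φ.split (i + 1))⁻¹) = c * b⁻¹ := by
    intro c b
    rw [mul_inv, mul_left_comm, mul_left_comm (Φ.split (i + 1)),
      mul_inv_cancel₀ (Φ.split_ne_zero hξ h0 i hi), mul_one]
  rw [e]
  ring

/-- Here `w_d = ξ` is an eigenvector of `A` for `θ_0`, so the defect is a multiple of `(λ - θ_0) η_d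
= η_{d+1}`. -/
theorem polyMap_A_splitVec_last (Φ : THSystem K V d) {ξ : V}
    (hξ : ξ ∈ LinearMap.range (Φ.E 0)) (h0 : ξ ≠ 0) :
    X * Φ.polyMap hξ h0 (Φ.splitVec ξ d) =
      Φ.polyMap hξ h0 (Φ.A (Φ.splitVec ξ d)) +
        C (subdiagProd (Φ.standardMatrix hξ h0))⁻¹ * ∏ i, (X - C (Φ.eigenvalue i)) := by
  have hc : (etaPoly Φ.dualEigenvalue d).eval (Φ.dualEigenvalue 0) ≠ 0 :=
    eval_etaPoly_ne_zero Φ.dualEigenvalue_spec.1 0 (by simp)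
  have e : (etaPoly Φ.dualEigenvalue d).eval (Φ.dualEigenvalue 0) *
      (∏ k ∈ Finset.Icc 1 d, Φ.split k)⁻¹ = (subdiagProd (Φ.standardMatrix hξ h0))⁻¹ := by
    rw [← Φ.subdiagProd_mul_eval hξ h0, mul_inv, mul_left_comm, mul_inv_cancel₀ hc, mul_one]
  have e0 : (⟨d - d, by omega⟩ : Fin (d + 1)) = 0 := Fin.ext (by simp)
  rw [Φ.A_splitVec_last hξ, map_smul, Φ.polyMap_splitVec hξ h0 d le_rfl, e, ← etaPoly_card,
    etaPoly_succ _ d (by omega), e0, smul_eq_C_mul]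
  ring

theorem X_mul_polyMap_Estar (Φ : THSystem K V d) {ξ : V}
    (hξ : ξ ∈ LinearMap.range (Φ.E 0)) (h0 : ξ ≠ 0) (j : Fin (d + 1)) (hj : (j : ℕ) < d) :
    X * Φ.polyMap hξ h0 (Φ.Estar j ξ) = Φ.polyMap hξ h0 (Φ.A (Φ.Estar j ξ)) := by
  have hN := Φ.ellDenom_ne_zero j
  -- The `w_d` term, the only one with a defect, has coefficient `τ*_d(θ*_j) = 0` because `j < d`.
  rw [← inv_smul_smul₀ hN (Φ.Estar j ξ), ← sum_splitVec, Finset.sum_range_succ,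
    eval_tauPoly_eq_zero _ j hj, zero_smul, add_zero]
  simp only [map_smul, map_sum, mul_smul_comm, Finset.mul_sum]
  congr 1
  refine Finset.sum_congr rfl fun k hk => ?_
  rw [Φ.polyMap_A_splitVec hξ h0 k (Finset.mem_range.1 hk)]

theorem X_mul_polyMap_Estar_last (Φ : THSystem K V d) {ξ : V}
    (hξ : ξ ∈ LinearMap.range (Φ.E 0)) (h0 : ξ ≠ 0) :
    X * Φ.polyMap hξ h0 (Φ.Estar (Fin.last d) ξ) =
      C (subdiagProd (Φ.standardMatrix hξ h0))⁻¹ * ∏ i, (X - C (Φ.eigenvalue i)) +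
        Φ.polyMap hξ h0 (Φ.A (Φ.Estar (Fin.last d) ξ)) := by
  have h1 := Φ.sum_splitVec ξ (Fin.last d)
  have ht := eval_tauPoly_ne_zero Φ.dualEigenvalue_spec.1 (h := d) (Fin.last d) le_rfl
  have e : (etaPoly Φ.dualEigenvalue (d - (Fin.last d : Fin (d + 1)))).eval
      (Φ.dualEigenvalue (Fin.last d)) = 1 := by simp [etaPoly_zero]
  rw [e, mul_one, Fin.val_last] at h1
  -- For `i = d` the scalar in `sum_splitVec` is `τ*_d(θ*_d)`, which is also the coefficient of
  -- `w_d`; hence `w_d` occurs in `E*_d ξ` with coefficient 1 and the defect passes unscaled.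
  rw [← inv_smul_smul₀ ht (Φ.Estar (Fin.last d) ξ), ← h1, Finset.sum_range_succ]
  simp only [map_smul, map_add, map_sum, mul_smul_comm, mul_add, Finset.mul_sum]
  rw [Φ.polyMap_A_splitVec_last hξ h0,
    Finset.sum_congr rfl fun k hk => congrArg _
      (Φ.polyMap_A_splitVec hξ h0 k (Finset.mem_range.1 hk)),
    smul_add, smul_add, smul_add, smul_add, inv_smul_smul₀ ht, inv_smul_smul₀ ht]
  abel

/-- The initial condition `s_0 = 1`: the factor `η*_d(θ*_0)` in `polyMap` makes `ℓ_0 = 1`, and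
`τ*_h(θ*_0) = 0` for `h ≥ 1` leaves `p(λ, θ*_0) = 1`. -/
theorem polyMap_Estar_zero (Φ : THSystem K V d) {ξ : V}
    (hξ : ξ ∈ LinearMap.range (Φ.E 0)) (h0 : ξ ≠ 0) : Φ.polyMap hξ h0 (Φ.Estar 0 ξ) = 1 := by
  have hc : (etaPoly Φ.dualEigenvalue d).eval (Φ.dualEigenvalue 0) ≠ 0 :=
    eval_etaPoly_ne_zero Φ.dualEigenvalue_spec.1 0 (by simp)
  rw [polyMap_Estar, twoVarPolyAt_eq, Finset.sum_range_succ', Finset.sum_eq_zero]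
  · simp [ell, tauPoly_zero, etaPoly_zero, div_self hc]
  · intro k _
    rw [eval_tauPoly_eq_zero _ 0 (by simp)]
    simp

theorem sPoly_eq (Φ : THSystem K V d) (ξ : V)
    (hξ : ξ ∈ LinearMap.range (Φ.E 0)) (h0 : ξ ≠ 0) :
    Φ.sPoly ξ hξ h0 = Fin.snoc (α := fun _ => K[X])
      (fun i : Fin (d + 1) => C (Φ.ell i) * Φ.twoVarPolyAt (Φ.dualEigenvalue i))
      (∏ i : Fin (d + 1), (X - C (Φ.eigenvalue i))) := by
  have hsum : ∀ j, ∑ i, C (Φ.standardMatrix hξ h0 i j) * Φ.polyMap hξ h0 (Φ.Estar i ξ) =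
      Φ.polyMap hξ h0 (Φ.A (Φ.Estar j ξ)) := by
    intro j
    rw [← Φ.sum_standardMatrix hξ h0 j, map_sum]
    simp [smul_eq_C_mul]
  simp only [← Φ.polyMap_Estar hξ h0]
  refine eq_hessPoly (Φ.isHessenberg_standardMatrix hξ h0) _ ?_ ?_ ?_
  · rw [← Fin.castSucc_zero, Fin.snoc_castSucc, polyMap_Estar_zero]
  · intro j hj
    simp only [Fin.snoc_castSucc, hsum]
    exact Φ.X_mul_polyMap_Estar hξ h0 j hj
  · simp only [Fin.snoc_castSucc, Fin.snoc_last, hsum]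
    exact Φ.X_mul_polyMap_Estar_last hξ h0

end THSystem

theorem corollary17p13 {K V : Type*} [Field K] [AddCommGroup V] [Module K V] {d : ℕ}
    (Φ : THSystem K V d) (ξ : V) (hξ : ξ ∈ LinearMap.range (Φ.E 0)) (h0 : ξ ≠ 0) :
    (∀ i : Fin (d + 1),
      Φ.tPoly ξ hξ h0 i.castSucc = Φ.twoVarPolyAt (Φ.dualEigenvalue i)) ∧
    Φ.tPoly ξ hξ h0 (Fin.last (d + 1)) = ∏ i : Fin (d + 1), (X - C (Φ.eigenvalue i)) ∧
    (∀ i : Fin (d + 1),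
      Φ.sPoly ξ hξ h0 i.castSucc =
        C (Φ.ell i) * Φ.twoVarPolyAt (Φ.dualEigenvalue i)) ∧
    Φ.sPoly ξ hξ h0 (Fin.last (d + 1)) = ∏ i : Fin (d + 1), (X - C (Φ.eigenvalue i)) := by
  have hs : ∀ i : Fin (d + 1), Φ.sPoly ξ hξ h0 i.castSucc =
      C (Φ.ell i) * Φ.twoVarPolyAt (Φ.dualEigenvalue i) := fun i => by
    rw [Φ.sPoly_eq, Fin.snoc_castSucc]
  have hl : Φ.sPoly ξ hξ h0 (Fin.last (d + 1)) =
      ∏ i : Fin (d + 1), (X - C (Φ.eigenvalue i)) := by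
    rw [Φ.sPoly_eq, Fin.snoc_last]
  refine ⟨fun i => ?_, ?_, hs, hl⟩
  · rw [THSystem.tPoly, Fin.snoc_castSucc, hs, ← mul_assoc, ← C_mul,
      inv_mul_cancel₀ (Φ.ell_ne_zero i), C_1, one_mul]
  · rw [THSystem.tPoly, Fin.snoc_last, hl]
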